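/- Let $U_2$ be a real orthogonal (i.e. unitary with real entries) finite matrix whose $1$-eigenspace is spanned by a single real unit vector $|\phi_0\rangle$, let $|\mu\rangle$ be a real unit vector, and put $U=U_2(I-2|\mu\rangle\langle\mu|)$ and $|\widetilde\phi_0\rangle=|\phi_0\rangle-\langle\mu|\phi_0\rangle|\mu\rangle$ (not normalized). For an eigenvalue $\mathrm e^{\mathrm i\alpha}$ of $U$ with $\alpha\in(-\pi,\pi]$ let $p_\alpha$ be the squared norm of the orthogonal projection of $|\widetilde\phi_0\rangle$ to its eigenspace. Let $\mathit{QH}$ take the value $1/|\alpha|$ (the value $0$ if $\alpha=0$) with weight $p_\alpha$, for each eigenvalue; the weights sum to $\|\widetilde\phi_0\|^2\le 1$. For $0<\varepsilon<1$ put $$\mathsf{QHT}_\varepsilon(U_2,|\mu\rangle)=\min\{y\ge 0:\Pr[\mathit{QH}>y]\le\varepsilon\}.$$ For $0<\Delta\le 1$ let $\mathbf{Estimate}$ be the standard phase estimation circuit for $U$ with precision $\Delta$: it uses $t=\lceil\log_2(2\pi/\Delta)\rceil$ ancilla qubits initialized to $|0\rangle$, and it consists of Hadamard gates on all ancilla qubits,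 $2^q$ applications of $U$ controlled by qubit $q$ for $q=0,\dots,t-1$, the inverse quantum Fourier transform on the ancilla, and a measurement of the ancilla; the outcome $y\in\{0,\dots,2^t-1\}$ is read as the phase $2\pi y/2^t$, reduced modulo $2\pi$ to $(-\pi,\pi]$. Fix a constant $c\ge 1/\ln 3$. The procedure $\mathbf{Detect}(U,\Delta,\varepsilon)$ applies $\mathbf{Estimate}$ with precision $\Delta$ successively $\lceil c\ln(1/\varepsilon)\rceil$ times to the same system register, with fresh ancilla qubits each time, and accepts if and only if at least one of the estimated phases is nonzero. On an unnormalized input, the probability of a list of outcomes is the squared norm of the resulting unnormalized final state. **Theorem.** There is a constant $K>0$, depending only on $c$, such that for all $U_2$, $|\mu\rangle$, $|\phi_0\rangle$ as above, every $0<\varepsilon<1$ and every real $T\ge\max\{1,\mathsf{QHT}_\varepsilon(U_2,|\mu\rangle)\}$ the following holds. 1. If $\langle\phi_0|\mu\rangle\ne 0$, then $\mathbf{Detect}(U,1/T,\varepsilon)$ accepts $|\widetilde\phi_0\rangle$ with a probability between $\|\widetilde\phi_0\|^2-K\varepsilon$ and $\|\widetilde\phi_0\|^2$. 2. If $\langle\phi_0|\mu\rangle=0$,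 then $\mathbf{Detect}(U,1/T,\varepsilon)$ accepts $|\widetilde\phi_0\rangle$ with probability $0$. 3. The number of applications of controlled-$U$ made by $\mathbf{Detect}(U,1/T,\varepsilon)$ is at most $K(1+\ln(1/\varepsilon))\,T$, and at most $K\ln(1/\varepsilon)\,T$ if $\varepsilon\le 1/2$. -/

import Mathlib

open scoped InnerProductSpace

noncomputable section

/-! ### Circuits with black-box access to a controlled operator

A circuit acts on `t` ancilla qubits together with a system register whose state space is `E`.
A joint (unnormalized) state is given by its components `⟨b| ⊗ id`, one vector of `E` for each
basis state `b` of the ancilla. -/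

/-- Gates: a Hadamard gate on an ancilla qubit, one application of the black-box operator
to the system controlled by an ancilla qubit, and the inverse quantum Fourier transform on the
whole ancilla register. -/
inductive QGate (t : ℕ) where
  | hadamard (q : Fin t) : QGate t
  | controlledU (q : Fin t) : QGate t
  | inverseQFT : QGate t

/-- Joint states of `t` qubits and a system with state space `E`. -/
abbrev JointState (t : ℕ) (E : Type*) := (Fin t → Bool) → E

/-- The integer in `{0, …, 2 ^ t - 1}` with binary digits `b` (`b j` has weight `2 ^ j`). -/
def bitsValue {t : ℕ} (b : Fin t → Bool) : ℕ :=
  ∑ j : Fin t, if b j then 2 ^ (j : ℕ) else 0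

section Semantics

variable {E : Type*} [NormedAddCommGroup E] [InnerProductSpace ℂ E]

/-- Action of a gate on joint states, when the black-box operator is `U`. -/
def QGate.apply {t : ℕ} (U : Module.End ℂ E) : QGate t → JointState t E → JointState t E
  | .hadamard q, s => fun b =>
      ((1 / Real.sqrt 2 : ℝ) : ℂ) •
        (s (Function.update b q false) +
          (if b q then (-1 : ℂ) else 1) • s (Function.update b q true))
  | .controlledU q, s => fun b => if b q then U (s b) else s b
  | .inverseQFT, s => fun b =>
      ((1 / Real.sqrt (2 ^ t) : ℝ) : ℂ) •
        ∑ b' : Fin t → Bool,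
          Complex.exp (-(2 * Real.pi * Complex.I * (bitsValue b : ℂ) * (bitsValue b' : ℂ) / 2 ^ t))
            • s b'

/-- A circuit is a sequence of gates, executed from left to right. -/
abbrev QCircuit (t : ℕ) := List (QGate t)

/-- Execution of a circuit. -/
def QCircuit.run {t : ℕ} (U : Module.End ℂ E) : QCircuit t → JointState t E → JointState t E
  | [], s => s
  | g :: C, s => QCircuit.run U C (g.apply U s)

/-- The joint state `|0…0⟩ ⊗ ψ`. -/
def initState (t : ℕ) (ψ : E) : JointState t E :=
  fun b => if b = fun _ => false then ψ else 0

/-- `1` for an application of the controlled black-box operator, `0` for the other gates. -/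
def QGate.cost {t : ℕ} : QGate t → ℕ
  | .controlledU _ => 1
  | _ => 0

/-- The number of applications of the controlled black-box operator in a circuit. -/
def QCircuit.controlledUCount {t : ℕ} (C : QCircuit t) : ℕ := (C.map QGate.cost).sum

/-! ### Procedures: circuits with intermediate measurements -/

/-- A procedure with `t` ancilla qubits: its circuits are executed one after the other on the same
system register, each of them with the ancilla freshly initialized to `|0…0⟩` and followed by a
measurement of the ancilla in the computational basis. At the end the procedure accepts or rejects
according to the list of the measurement outcomes. -/
structure QProcedure where
  t : ℕ
  rounds : List (QCircuit t)
  accepts : List (Fin t → Bool) → Prop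

open Classical in
/-- Probability that the outcome list, extending the earlier outcomes `hist`, satisfies `acc`.
States are unnormalized: after outcome `b` the system is left in the component `b` of the joint
state, and the squared norm of the final vector is the probability of the whole outcome list. -/
def acceptProbAux {t : ℕ} (U : Module.End ℂ E) (acc : List (Fin t → Bool) → Prop) :
    List (QCircuit t) → List (Fin t → Bool) → E → ℝ
  | [], hist, ψ => if acc hist then ‖ψ‖ ^ 2 else 0
  | C :: Cs, hist, ψ =>
      ∑ b : Fin t → Bool, acceptProbAux U acc Cs (hist ++ [b]) (C.run U (initState t ψ) b)

/-- Probability that the procedure, run with black-box operator `U`, accepts the (possibly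
unnormalized) input state `ψ`. -/
def QProcedure.acceptProb (A : QProcedure) (U : Module.End ℂ E) (ψ : E) : ℝ :=
  acceptProbAux U A.accepts A.rounds [] ψ

/-- Total number of applications of the controlled black-box operator. -/
def QProcedure.controlledUCount (A : QProcedure) : ℕ :=
  (A.rounds.map QCircuit.controlledUCount).sum

/-! ### Phase estimation and the procedure Detect -/

/-- Number of ancilla qubits for phase estimation with precision `Δ`: the least `t` with
`2 ^ t ≥ 2 * π / Δ`. For an eigenvalue `e^{iα}`, the estimate of `α` is then, with probability
at least `8 / π ^ 2 ≥ 2 / 3`, one of the two multiples of `2 * π / 2 ^ t ≤ Δ` next to `α`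
(modulo `2 * π`). -/
def precisionBits (Δ : ℝ) : ℕ := ⌈Real.logb 2 (2 * Real.pi / Δ)⌉₊

/-- The textbook phase estimation circuit with `t` ancilla qubits: Hadamard gates on all ancilla
qubits, then `U ^ (2 ^ q)` controlled by qubit `q` for every `q`, then the inverse quantum Fourier
transform. -/
def phaseEstimationCircuit (t : ℕ) : QCircuit t :=
  (List.finRange t).map QGate.hadamard ++
    (List.finRange t).flatMap (fun q : Fin t => List.replicate (2 ^ (q : ℕ)) (QGate.controlledU q)) ++
    [QGate.inverseQFT]

/-- The estimated phase in `(-π, π]` belonging to a measurement outcome. -/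
def estimatedPhase {t : ℕ} (b : Fin t → Bool) : ℝ :=
  if 2 * bitsValue b ≤ 2 ^ t then 2 * Real.pi * bitsValue b / 2 ^ t
  else 2 * Real.pi * bitsValue b / 2 ^ t - 2 * Real.pi

/-- The procedure Detect with precision `Δ` and error parameter `ε`: apply phase estimation with
precision `Δ` to the same state `⌈c * log (1 / ε)⌉` times, and accept if at least one of the
estimated phases is nonzero. -/
def detect (c Δ ε : ℝ) : QProcedure where
  t := precisionBits Δ
  rounds := List.replicate ⌈c * Real.log (1 / ε)⌉₊ (phaseEstimationCircuit (precisionBits Δ))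
  accepts := fun outcomes => ∃ b ∈ outcomes, estimatedPhase b ≠ 0

/-! ### The random variable QH -/

/-- The value of QH on the eigenvalue `z = e^{iα}`, `α ∈ (-π, π]`: `1 / |α|` if `α ≠ 0`,
and `0` if `α = 0`. -/
def qhValue (z : ℂ) : ℝ := if z = 1 then 0 else 1 / |Complex.arg z|

variable [FiniteDimensional ℂ E]

open Classical in
/-- `Pr [QH > y]` for the unitary `U` and the state `ψ`: the eigenvalue `z` of `U` has as its
weight the squared norm of the orthogonal projection of `ψ` to the eigenspace of `z`. (If `U` and
`ψ` are real, conjugate eigenvalues `e^{iα_j}`, `e^{-iα_j}` have the same weight `δ_j ^ 2` and the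
same QH value `1 / α_j`, which therefore is taken with probability `2 * δ_j ^ 2`.) -/
def qhTail (U : Module.End ℂ E) (ψ : E) (y : ℝ) : ℝ :=
  ∑ z : Module.End.Eigenvalues U,
    if y < qhValue (z : ℂ) then ‖(Module.End.eigenspace U (z : ℂ)).starProjection ψ‖ ^ 2 else 0

/-- `min {y ≥ 0 : Pr [QH > y] ≤ ε}`. -/
def epsHittingTime (U : Module.End ℂ E) (ψ : E) (ε : ℝ) : ℝ :=
  sInf {y : ℝ | 0 ≤ y ∧ qhTail U ψ y ≤ ε}

open Classical in
/-- The minimum in the definition of `epsHittingTime` is attained. -/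
theorem epsHittingTime_isLeast (U : Module.End ℂ E) (ψ : E) (ε : ℝ) (hε : 0 < ε) :
    IsLeast {y : ℝ | 0 ≤ y ∧ qhTail U ψ y ≤ ε} (epsHittingTime U ψ ε) := by
  let F : Finset ℝ := insert 0 (Finset.univ.image fun z : Module.End.Eigenvalues U => qhValue (z : ℂ))
  have hval : ∀ z : ℂ, 0 ≤ qhValue z := by
    intro z
    unfold qhValue
    split_ifs <;> positivity
  have hF0 : ∀ f ∈ F, 0 ≤ f := by
    intro f hf
    rcases Finset.mem_insert.1 hf with rfl | hf
    · exact le_rfl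
    · obtain ⟨z, -, rfl⟩ := Finset.mem_image.1 hf
      exact hval _
  have key : ∀ y, 0 ≤ y → qhTail U ψ y ≤ ε → ∃ f ∈ F, f ≤ y ∧ qhTail U ψ f ≤ ε := by
    intro y hy h
    have hne : (F.filter (· ≤ y)).Nonempty := ⟨0, by simp [F, hy]⟩
    obtain ⟨f, hf, hmax⟩ := (F.filter (· ≤ y)).exists_max_image id hne
    rw [Finset.mem_filter] at hf
    refine ⟨f, hf.1, hf.2, le_trans (le_of_eq ?_) h⟩
    unfold qhTail
    refine Finset.sum_congr rfl fun z _ => ?_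
    have hz : f < qhValue (z : ℂ) ↔ y < qhValue (z : ℂ) := by
      refine ⟨fun h1 => ?_, fun h1 => lt_of_le_of_lt hf.2 h1⟩
      by_contra h2
      have := hmax (qhValue (z : ℂ)) (by simp [F, not_lt.1 h2])
      exact absurd h1 (not_lt.2 this)
    simp only [hz]
  have hne : (F.filter fun f => qhTail U ψ f ≤ ε).Nonempty := by
    obtain ⟨f, hf, hmax⟩ := F.exists_max_image id ⟨0, by simp [F]⟩
    refine ⟨f, Finset.mem_filter.2 ⟨hf, ?_⟩⟩
    have : qhTail U ψ f = 0 := by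
      unfold qhTail
      refine Finset.sum_eq_zero fun z _ => if_neg (not_lt.2 ?_)
      exact hmax (qhValue (z : ℂ)) (by simp [F])
    rw [this]
    exact hε.le
  obtain ⟨m, hm, hmin⟩ := (F.filter fun f => qhTail U ψ f ≤ ε).exists_min_image id hne
  rw [Finset.mem_filter] at hm
  have hleast : IsLeast {y : ℝ | 0 ≤ y ∧ qhTail U ψ y ≤ ε} m := by
    refine ⟨⟨hF0 m hm.1, hm.2⟩, ?_⟩
    rintro y ⟨hy, h⟩
    obtain ⟨f, hf, hfy, hft⟩ := key y hy h
    exact le_trans (hmin f (Finset.mem_filter.2 ⟨hf, hft⟩)) hfy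
  have : epsHittingTime U ψ ε = m := hleast.csInf_eq
  rw [this]
  exact hleast

end Semantics

/-! ### Abstract search -/

section Search

variable {ι : Type*} [Fintype ι] [DecidableEq ι]

/-- A real vector, viewed as a complex vector. -/
def complexify (v : EuclideanSpace ℝ ι) : EuclideanSpace ℂ ι :=
  WithLp.toLp 2 fun x => (v x : ℂ)

/-- The operator `U = U₂ U₁`, `U₁ = I - 2 |μ⟩⟨μ|`, on the complex Euclidean space. -/
def searchOperator (U₂ : Matrix ι ι ℝ) (μ : EuclideanSpace ℝ ι) :
    Module.End ℂ (EuclideanSpace ℂ ι) :=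
  Matrix.toEuclideanLin
    ((U₂ * (1 - (2 : ℝ) • Matrix.vecMulVec (fun x => μ x) (fun x => μ x))).map Complex.ofReal)

/-- The initial vector `φ₀ - ⟨μ|φ₀⟩ μ`. -/
def startVector (μ φ₀ : EuclideanSpace ℝ ι) : EuclideanSpace ℝ ι :=
  φ₀ - ⟪μ, φ₀⟫_ℝ • μ

/-- The quantum `ε`-error `μ`-hitting time of `U₂`, where `φ₀` is the `1`-eigenvector of `U₂`
(unique up to sign, which does not matter here). -/
def quantumHittingTime (U₂ : Matrix ι ι ℝ) (μ φ₀ : EuclideanSpace ℝ ι) (ε : ℝ) : ℝ :=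
  epsHittingTime (searchOperator U₂ μ) (complexify (startVector μ φ₀)) ε

end Search

end

/-!
The outcome `0` of one round of phase estimation with `N = 2 ^ t` acts on the system register as the
mean `N⁻¹ ∑_{k < N} U ^ k`, so `Detect` rejects with the squared norm of a power of this mean
applied to the start vector. On the eigenvalue `e^{iα}` the mean is a geometric sum of modulus at
most `1`, and at most `1 / 2` once `2 π ≤ N |α|`, which the precision `1 / T` guarantees for
`|α| ≥ 1 / T`. The components with `0 < |α| < 1 / T` have total weight at most `ε` by definition of
the hitting time, so after `k ≥ ln (1 / ε) / ln 4` rounds the rejection probability is `O(ε)`,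
provided that `1` is not an eigenvalue of `U`. This is the case when `⟨φ₀|μ⟩ ≠ 0`; when
`⟨φ₀|μ⟩ = 0` the start vector is fixed by `U`, and every round yields `0`.
-/

noncomputable section

section BitStrings

variable {t : ℕ}

/-- Bit strings of length `t` as the numbers they represent, `b j` having weight `2 ^ j`. -/
def bitsEquivFin (t : ℕ) : (Fin t → Bool) ≃ Fin (2 ^ t) :=
  (Equiv.arrowCongr (Equiv.refl _) finTwoEquiv.symm).trans finFunctionFinEquiv

lemma val_bitsEquivFin (b : Fin t → Bool) : (bitsEquivFin t b : ℕ) = bitsValue b := by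
  simp only [bitsEquivFin, Equiv.trans_apply, finFunctionFinEquiv_apply, bitsValue]
  refine Finset.sum_congr rfl fun j _ => ?_
  cases h : b j <;> simp [h, finTwoEquiv]

lemma bitsValue_lt (b : Fin t → Bool) : bitsValue b < 2 ^ t :=
  val_bitsEquivFin b ▸ (bitsEquivFin t b).isLt

lemma bitsValue_false : bitsValue (fun _ : Fin t => false) = 0 := by
  simp [bitsValue]

lemma bitsValue_eq_zero_iff {b : Fin t → Bool} : bitsValue b = 0 ↔ b = fun _ => false := by
  rw [← bitsValue_false (t := t), ← val_bitsEquivFin, ← val_bitsEquivFin, Fin.val_inj,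
    (bitsEquivFin t).apply_eq_iff_eq]

lemma sum_bitsValue {M : Type*} [AddCommMonoid M] (f : ℕ → M) :
    ∑ b : Fin t → Bool, f (bitsValue b) = ∑ k ∈ Finset.range (2 ^ t), f k := by
  simp only [← val_bitsEquivFin]
  rw [(bitsEquivFin t).sum_comp fun k => f k, Fin.sum_univ_eq_sum_range]

lemma estimatedPhase_eq_zero_iff {b : Fin t → Bool} :
    estimatedPhase b = 0 ↔ b = fun _ => false := by
  have hlt : 2 * Real.pi * bitsValue b / 2 ^ t < 2 * Real.pi := by
    rw [div_lt_iff₀ (by positivity)]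
    gcongr
    exact_mod_cast bitsValue_lt b
  rw [← bitsValue_eq_zero_iff, estimatedPhase]
  split_ifs with hle
  · simp [Real.pi_ne_zero]
  · refine iff_of_false (by linarith) fun h => hle (by simp [h])

lemma zmodFinEquiv_apply {N : ℕ} [NeZero N] (a : Fin N) : ZMod.finEquiv N a = (a : ℕ) := by
  cases N with
  | zero => exact a.elim0
  | succ n => exact (Fin.cast_val_eq_self a).symm

/-- Bit strings of length `t` as residues modulo `2 ^ t`, under which the Fourier transform of the
ancilla register becomes `ZMod.dft`. -/
def bitsEquivZMod (t : ℕ) : (Fin t → Bool) ≃ ZMod (2 ^ t) :=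
  (bitsEquivFin t).trans (ZMod.finEquiv (2 ^ t)).toEquiv

lemma bitsEquivZMod_apply (b : Fin t → Bool) :
    bitsEquivZMod t b = (bitsValue b : ZMod (2 ^ t)) := by
  rw [← val_bitsEquivFin]
  exact zmodFinEquiv_apply (bitsEquivFin t b)

end BitStrings

section FourierTransform

open ZMod

variable {E : Type*} [NormedAddCommGroup E] [InnerProductSpace ℂ E]

lemma sum_norm_sq_zmodDFT {N : ℕ} [NeZero N] (Φ : ZMod N → E) :
    ∑ k, ‖𝓕 Φ k‖ ^ 2 = N * ∑ j, ‖Φ j‖ ^ 2 := by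
  have inner_dft (j : ZMod N) : ∑ k, ⟪stdAddChar (-(j * k)) • Φ j, 𝓕 Φ k⟫_ℂ = N * ⟪Φ j, Φ j⟫_ℂ := by
    calc
      ∑ k, ⟪stdAddChar (-(j * k)) • Φ j, 𝓕 Φ k⟫_ℂ
          = ⟪Φ j, ∑ k, stdAddChar (-(k * -j)) • 𝓕 Φ k⟫_ℂ := by
        simp only [inner_sum, inner_smul_left, inner_smul_right, ← AddChar.map_neg_eq_conj]
        simp only [neg_neg, mul_neg, mul_comm j]
      _ = ⟪Φ j, 𝓕 (𝓕 Φ) (-j)⟫_ℂ := by rw [dft_apply (𝓕 Φ)]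
      _ = N * ⟪Φ j, Φ j⟫_ℂ := by simp [dft_dft]
  have key : ∑ k, ⟪𝓕 Φ k, 𝓕 Φ k⟫_ℂ = N * ∑ j, ⟪Φ j, Φ j⟫_ℂ := by
    calc
      ∑ k, ⟪𝓕 Φ k, 𝓕 Φ k⟫_ℂ = ∑ j, ∑ k, ⟪stdAddChar (-(j * k)) • Φ j, 𝓕 Φ k⟫_ℂ := by
        rw [Finset.sum_comm]
        refine Finset.sum_congr rfl fun k _ => ?_
        conv_lhs => rw [dft_apply, sum_inner]
        rfl
      _ = N * ∑ j, ⟪Φ j, Φ j⟫_ℂ := by simp only [inner_dft, Finset.mul_sum]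
  simp only [inner_self_eq_norm_sq_to_K, Complex.coe_algebraMap] at key
  exact_mod_cast key

lemma inverseQFT_apply_eq_zmodDFT {t : ℕ} (U : Module.End ℂ E) (s : JointState t E)
    (b : Fin t → Bool) :
    QGate.inverseQFT.apply U s b =
      ((1 / Real.sqrt (2 ^ t) : ℝ) : ℂ) •
        𝓕 (s ∘ (bitsEquivZMod t).symm) (bitsEquivZMod t b) := by
  rw [QGate.apply, dft_apply, ← (bitsEquivZMod t).sum_comp]
  refine congrArg _ (Finset.sum_congr rfl fun b' _ => ?_)
  have hchar : -(bitsEquivZMod t b' * bitsEquivZMod t b) =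
      ((-(bitsValue b * bitsValue b') : ℤ) : ZMod (2 ^ t)) := by
    rw [bitsEquivZMod_apply, bitsEquivZMod_apply]
    push_cast
    ring
  rw [hchar, stdAddChar_coe, Function.comp_apply, Equiv.symm_apply_apply]
  congr 2
  push_cast
  ring

lemma sum_norm_sq_inverseQFT {t : ℕ} (U : Module.End ℂ E) (s : JointState t E) :
    ∑ b, ‖QGate.inverseQFT.apply U s b‖ ^ 2 = ∑ b, ‖s b‖ ^ 2 := by
  have hsqrt : ‖((1 / Real.sqrt (2 ^ t) : ℝ) : ℂ)‖ ^ 2 = ((2 : ℝ) ^ t)⁻¹ := by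
    simp [abs_of_nonneg, Real.sqrt_nonneg, inv_pow]
  simp only [inverseQFT_apply_eq_zmodDFT, norm_smul, mul_pow, hsqrt]
  rw [← Finset.mul_sum, (bitsEquivZMod t).sum_comp fun k => ‖𝓕 (s ∘ (bitsEquivZMod t).symm) k‖ ^ 2,
    sum_norm_sq_zmodDFT, ← (bitsEquivZMod t).symm.sum_comp fun b => ‖s b‖ ^ 2]
  simp only [Function.comp_apply]
  push_cast
  field_simp

end FourierTransform

section Circuits

variable {E : Type*} [NormedAddCommGroup E] [InnerProductSpace ℂ E] {t : ℕ}

lemma QCircuit.run_append (U : Module.End ℂ E) (C D : QCircuit t) (s : JointState t E) :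
    QCircuit.run U (C ++ D) s = D.run U (C.run U s) := by
  induction C generalizing s with
  | nil => rfl
  | cons _ _ ih => exact ih _

/-- The joint state with system part `ψ` in which the ancilla qubits of `S` are in uniform
superposition and the others are in state `|0⟩`: the state in which Hadamard gates on `S` put
`initState t ψ`. -/
def superposedState (S : Finset (Fin t)) (ψ : E) : JointState t E :=
  fun b => if ∀ q ∉ S, b q = false then ((1 / Real.sqrt 2 : ℝ) : ℂ) ^ S.card • ψ else 0

lemma superposedState_empty (ψ : E) : superposedState ∅ ψ = initState t ψ := by
  funext b
  simp [superposedState, initState, funext_iff]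

lemma superposedState_univ (ψ : E) :
    superposedState Finset.univ ψ =
      fun _ : Fin t → Bool => ((1 / Real.sqrt 2 : ℝ) : ℂ) ^ t • ψ := by
  funext b
  simp [superposedState]

lemma hadamard_superposedState (U : Module.End ℂ E) {S : Finset (Fin t)} {q : Fin t} (hq : q ∉ S)
    (ψ : E) :
    (QGate.hadamard q).apply U (superposedState S ψ) = superposedState (insert q S) ψ := by
  funext b
  have hupdate_true : ¬ ∀ r ∉ S, Function.update b q true r = false :=
    fun h => by simpa using h q hq
  have hupdate_false : (∀ r ∉ S, Function.update b q false r = false) ↔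
      ∀ r ∉ insert q S, b r = false := by
    refine forall_congr' fun r => ?_
    by_cases hr : r = q <;> simp [hr, hq]
  simp only [QGate.apply, superposedState, hupdate_true, hupdate_false, if_false, smul_zero,
    add_zero, smul_ite, smul_smul, Finset.card_insert_of_notMem hq, pow_succ']

lemma run_hadamards_superposedState (U : Module.End ℂ E) {l : List (Fin t)} (hl : l.Nodup)
    {S : Finset (Fin t)} (hS : ∀ q ∈ l, q ∉ S) (ψ : E) :
    QCircuit.run U (l.map QGate.hadamard) (superposedState S ψ) =
      superposedState (l.toFinset ∪ S) ψ := by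
  induction l generalizing S with
  | nil => simp [QCircuit.run]
  | cons q l ih =>
    obtain ⟨hql, hl⟩ := List.nodup_cons.1 hl
    obtain ⟨hqS, hlS⟩ := List.forall_mem_cons.1 hS
    have hl_insert : ∀ r ∈ l, r ∉ insert q S := fun r hr =>
      Finset.mem_insert.not.2 (not_or.2 ⟨fun h => hql (h ▸ hr), hlS r hr⟩)
    rw [List.map_cons, QCircuit.run, hadamard_superposedState U hqS, ih hl hl_insert,
      Finset.union_insert, List.toFinset_cons, Finset.insert_union]

lemma run_hadamards (U : Module.End ℂ E) (ψ : E) :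
    QCircuit.run U ((List.finRange t).map QGate.hadamard) (initState t ψ) =
      fun _ => ((1 / Real.sqrt 2 : ℝ) : ℂ) ^ t • ψ := by
  rw [← superposedState_empty, run_hadamards_superposedState U (List.nodup_finRange t) (by simp),
    Finset.union_empty, List.toFinset_finRange, superposedState_univ]

lemma run_replicate_controlledU (U : Module.End ℂ E) (q : Fin t) (n : ℕ) (s : JointState t E) :
    QCircuit.run U (List.replicate n (QGate.controlledU q)) s =
      fun b => (U ^ (if b q then n else 0)) (s b) := by
  induction n generalizing s with
  | zero => funext b; simp [QCircuit.run]
  | succ n ih =>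
    rw [List.replicate_succ, QCircuit.run, ih]
    funext b
    by_cases h : b q <;> simp [QGate.apply, h, pow_succ]

lemma run_controlledU_powers (U : Module.End ℂ E) (l : List (Fin t)) (s : JointState t E) :
    QCircuit.run U
        (l.flatMap fun q : Fin t => List.replicate (2 ^ (q : ℕ)) (QGate.controlledU q)) s =
      fun b => (U ^ (l.map fun q : Fin t => if b q then 2 ^ (q : ℕ) else 0).sum) (s b) := by
  induction l generalizing s with
  | nil => funext b; simp [QCircuit.run]
  | cons q l ih =>
    rw [List.flatMap_cons, QCircuit.run_append, run_replicate_controlledU, ih]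
    funext b
    rw [List.map_cons, List.sum_cons, add_comm, pow_add, Module.End.mul_apply]

lemma run_phaseEstimationCircuit (U : Module.End ℂ E) (ψ : E) :
    (phaseEstimationCircuit t).run U (initState t ψ) =
      QGate.inverseQFT.apply U
        fun b => (U ^ bitsValue b) (((1 / Real.sqrt 2 : ℝ) : ℂ) ^ t • ψ) := by
  have hbits (b : Fin t → Bool) :
      ((List.finRange t).map fun q => if b q then 2 ^ (q : ℕ) else 0).sum = bitsValue b := by
    rw [bitsValue, ← List.ofFn_eq_map, List.sum_ofFn]
  rw [phaseEstimationCircuit, QCircuit.run_append, QCircuit.run_append, run_hadamards,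
    run_controlledU_powers]
  simp only [hbits, QCircuit.run]

lemma sum_norm_sq_run_phaseEstimationCircuit (U : E →ₗᵢ[ℂ] E) (ψ : E) :
    ∑ b, ‖(phaseEstimationCircuit t).run U.toLinearMap (initState t ψ) b‖ ^ 2 = ‖ψ‖ ^ 2 := by
  have hpow (k : ℕ) (v : E) : ‖(U.toLinearMap ^ k) v‖ = ‖v‖ := by
    induction k with
    | zero => simp
    | succ k ih =>
      rw [pow_succ', Module.End.mul_apply, LinearIsometry.coe_toLinearMap, U.norm_map, ih]
  have hamplitude : ‖((1 / Real.sqrt 2 : ℝ) : ℂ) ^ t‖ ^ 2 = ((2 : ℝ) ^ t)⁻¹ := by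
    rw [norm_pow, Complex.norm_real, ← pow_mul, mul_comm, pow_mul]
    simp
  rw [run_phaseEstimationCircuit, sum_norm_sq_inverseQFT]
  simp only [hpow, norm_smul, mul_pow, hamplitude]
  simp

open Polynomial in
/-- The polynomial `N⁻¹ (1 + X + ⋯ + X ^ (N - 1))`. Evaluated at `U` with `N = 2 ^ t`, it is the
operator by which a round of phase estimation with outcome `0` acts on the system register. -/
def powerMean (N : ℕ) : ℂ[X] := C (N : ℂ)⁻¹ * ∑ k ∈ Finset.range N, X ^ k

lemma run_phaseEstimationCircuit_false (U : Module.End ℂ E) (ψ : E) :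
    (phaseEstimationCircuit t).run U (initState t ψ) (fun _ => false) =
      Polynomial.aeval U (powerMean (2 ^ t)) ψ := by
  have hscale : ((1 / Real.sqrt (2 ^ t) : ℝ) : ℂ) * ((1 / Real.sqrt 2 : ℝ) : ℂ) ^ t =
      ((2 ^ t : ℕ) : ℂ)⁻¹ := by
    have hsqrt : Real.sqrt (2 ^ t) = Real.sqrt 2 ^ t := by
      rw [Real.sqrt_eq_iff_eq_sq (by positivity) (by positivity), pow_right_comm,
        Real.sq_sqrt zero_le_two]
    have hreal : 1 / Real.sqrt (2 ^ t) * (1 / Real.sqrt 2) ^ t = ((2 : ℝ) ^ t)⁻¹ := by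
      rw [hsqrt, ← one_div_pow, ← mul_pow, div_mul_div_comm, Real.mul_self_sqrt zero_le_two]
      simp
    rw [← Complex.ofReal_pow, ← Complex.ofReal_mul, hreal]
    simp
  rw [run_phaseEstimationCircuit]
  simp only [QGate.apply, bitsValue_false, map_smul, Nat.cast_zero, mul_zero, zero_mul, zero_div,
    neg_zero, Complex.exp_zero, one_smul]
  rw [← Finset.smul_sum, sum_bitsValue fun k => (U ^ k) ψ, smul_smul, hscale]
  simp [powerMean, Module.algebraMap_end_apply, Finset.smul_sum]

end Circuits

section Acceptance

variable {E : Type*} [NormedAddCommGroup E] [InnerProductSpace ℂ E] {t : ℕ} {U : Module.End ℂ E}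

lemma acceptProbAux_of_forall_append {acc : List (Fin t → Bool) → Prop} {rounds : List (QCircuit t)}
    (hrounds : ∀ C ∈ rounds, ∀ ψ : E, ∑ b, ‖C.run U (initState t ψ) b‖ ^ 2 = ‖ψ‖ ^ 2)
    {hist : List (Fin t → Bool)} (hacc : ∀ l, acc (hist ++ l)) (ψ : E) :
    acceptProbAux U acc rounds hist ψ = ‖ψ‖ ^ 2 := by
  induction rounds generalizing hist ψ with
  | nil => rw [acceptProbAux, if_pos (by simpa using hacc [])]
  | cons C rounds ih =>
    obtain ⟨hC, hrounds⟩ := List.forall_mem_cons.1 hrounds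
    rw [acceptProbAux, ← hC]
    refine Finset.sum_congr rfl fun b _ => ih hrounds (fun l => ?_) _
    rw [List.append_assoc]
    exact hacc _

lemma acceptProbAux_replicate_exists_ne {C : QCircuit t}
    (hC : ∀ ψ : E, ∑ b, ‖C.run U (initState t ψ) b‖ ^ 2 = ‖ψ‖ ^ 2) (b₀ : Fin t → Bool) (k : ℕ)
    {hist : List (Fin t → Bool)} (hhist : ∀ b ∈ hist, b = b₀) (ψ : E) :
    acceptProbAux U (fun l => ∃ b ∈ l, b ≠ b₀) (List.replicate k C) hist ψ =
      ‖ψ‖ ^ 2 - ‖(fun φ => C.run U (initState t φ) b₀)^[k] ψ‖ ^ 2 := by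
  induction k generalizing hist ψ with
  | zero =>
    have hnot : ¬ ∃ b ∈ hist, b ≠ b₀ := fun ⟨b, hb, hne⟩ => hne (hhist b hb)
    simp [acceptProbAux, if_neg hnot]
  | succ k ih =>
    have hbranch (b : Fin t → Bool) :
        acceptProbAux U (fun l => ∃ b ∈ l, b ≠ b₀) (List.replicate k C) (hist ++ [b])
            (C.run U (initState t ψ) b) =
          ‖C.run U (initState t ψ) b‖ ^ 2 -
            if b = b₀ then ‖(fun φ => C.run U (initState t φ) b₀)^[k + 1] ψ‖ ^ 2 else 0 := by
      split_ifs with hb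
      · subst hb
        exact ih (by simpa [or_imp, forall_and] using hhist) _
      · rw [sub_zero]
        refine acceptProbAux_of_forall_append (fun D hD => List.eq_of_mem_replicate hD ▸ hC)
          (fun l => ⟨b, by simp, hb⟩) _
    rw [List.replicate_succ, acceptProbAux, Finset.sum_congr rfl fun b _ => hbranch b,
      Finset.sum_sub_distrib, hC, Finset.sum_ite_eq', if_pos (Finset.mem_univ _)]

lemma acceptProb_detect (U : E →ₗᵢ[ℂ] E) (c Δ ε : ℝ) (ψ : E) :
    (detect c Δ ε).acceptProb U.toLinearMap ψ =
      ‖ψ‖ ^ 2 - ‖Polynomial.aeval U.toLinearMap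
        (powerMean (2 ^ precisionBits Δ) ^ ⌈c * Real.log (1 / ε)⌉₊) ψ‖ ^ 2 := by
  simp only [QProcedure.acceptProb, detect, ne_eq, estimatedPhase_eq_zero_iff]
  rw [acceptProbAux_replicate_exists_ne (sum_norm_sq_run_phaseEstimationCircuit U) _ _ (by simp)]
  simp only [run_phaseEstimationCircuit_false]
  rw [map_pow, Module.End.pow_apply]

end Acceptance

section IsometrySpectrum

open Module.End

variable {𝕜 E : Type*} [RCLike 𝕜] [NormedAddCommGroup E] [InnerProductSpace 𝕜 E] (U : E →ₗᵢ[𝕜] E)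

lemma norm_eq_one_of_hasEigenvalue_isometry {z : 𝕜} (hz : HasEigenvalue U.toLinearMap z) :
    ‖z‖ = 1 := by
  obtain ⟨v, hv⟩ := hz.exists_hasEigenvector
  have hnorm : ‖z‖ * ‖v‖ = ‖v‖ := by
    rw [← norm_smul, ← hv.apply_eq_smul, LinearIsometry.coe_toLinearMap, U.norm_map]
  exact (mul_eq_right₀ (norm_ne_zero_iff.2 hv.2)).1 hnorm

lemma isOrtho_eigenspace_isometry {z w : 𝕜} (hz : ‖z‖ = 1) (hzw : z ≠ w) :
    eigenspace U.toLinearMap z ⟂ eigenspace U.toLinearMap w := by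
  refine Submodule.isOrtho_iff_inner_eq.2 fun v hv u hu => ?_
  have hinner : (starRingEnd 𝕜 z * w) * ⟪v, u⟫_𝕜 = ⟪v, u⟫_𝕜 := by
    conv_rhs => rw [← U.inner_map_map, ← U.coe_toLinearMap, mem_eigenspace_iff.1 hv,
      mem_eigenspace_iff.1 hu, inner_smul_left, inner_smul_right, ← mul_assoc]
  by_contra hne
  have hconj : starRingEnd 𝕜 z * w = starRingEnd 𝕜 z * z := by
    rw [(mul_eq_right₀ hne).1 hinner, RCLike.conj_mul, hz]
    simp
  have hz0 : starRingEnd 𝕜 z ≠ 0 := by simpa using norm_ne_zero_iff.1 (hz ▸ one_ne_zero)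
  exact hzw (mul_left_cancel₀ hz0 hconj).symm

lemma orthogonalFamily_eigenspaces_isometry :
    OrthogonalFamily 𝕜 (fun z : Eigenvalues U.toLinearMap => eigenspace U.toLinearMap (z : 𝕜))
      fun z => (eigenspace U.toLinearMap (z : 𝕜)).subtypeₗᵢ :=
  .of_pairwise fun z _ hzw =>
    isOrtho_eigenspace_isometry U (norm_eq_one_of_hasEigenvalue_isometry U z.2)
      (Subtype.coe_injective.ne hzw)

variable [FiniteDimensional 𝕜 E]

lemma orthogonal_mem_invtSubmodule_isometry {p : Submodule 𝕜 E}
    (hp : p ∈ invtSubmodule U.toLinearMap) : pᗮ ∈ invtSubmodule U.toLinearMap := by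
  have hsurj : Function.Surjective (U.toLinearMap.restrict hp) :=
    LinearMap.injective_iff_surjective.1 fun x y hxy =>
      Subtype.ext (U.injective (congrArg Subtype.val hxy))
  intro v hv
  refine (Submodule.mem_orthogonal p _).2 fun u hu => ?_
  obtain ⟨x, hx⟩ := hsurj ⟨u, hu⟩
  have hxu : U x = u := congrArg Subtype.val hx
  rw [← hxu, U.coe_toLinearMap, U.inner_map_map]
  exact (Submodule.mem_orthogonal p v).1 hv x x.2

lemma isSemisimple_isometry : IsSemisimple U.toLinearMap :=
  isSemisimple_iff.2 fun p hp =>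
    ⟨pᗮ, orthogonal_mem_invtSubmodule_isometry U hp, p.isCompl_orthogonal⟩

end IsometrySpectrum

section SpectralWeights

open Module.End

variable {E : Type*} [NormedAddCommGroup E] [InnerProductSpace ℂ E] [FiniteDimensional ℂ E]

lemma sum_starProjection_eigenspaces_isometry (U : E →ₗᵢ[ℂ] E) (ψ : E) :
    ∑ z : Eigenvalues U.toLinearMap, (eigenspace U.toLinearMap (z : ℂ)).starProjection ψ = ψ := by
  have htop : ⨆ z : Eigenvalues U.toLinearMap, eigenspace U.toLinearMap (z : ℂ) = ⊤ :=
    (iSup_ne_bot_subtype fun z => eigenspace U.toLinearMap z).trans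
      (isSemisimple_isometry U).iSup_eigenspace_eq_top
  exact (orthogonalFamily_eigenspaces_isometry U).sum_projection_of_mem_iSup ψ
    (htop ▸ Submodule.mem_top)

lemma norm_sq_aeval_isometry_apply (U : E →ₗᵢ[ℂ] E) (p : Polynomial ℂ) (ψ : E) :
    ‖Polynomial.aeval U.toLinearMap p ψ‖ ^ 2 =
      ∑ z : Eigenvalues U.toLinearMap,
        ‖p.eval (z : ℂ)‖ ^ 2 * ‖(eigenspace U.toLinearMap (z : ℂ)).starProjection ψ‖ ^ 2 := by
  have haeval : Polynomial.aeval U.toLinearMap p ψ = ∑ z : Eigenvalues U.toLinearMap,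
      p.eval (z : ℂ) • (eigenspace U.toLinearMap (z : ℂ)).starProjection ψ := by
    conv_lhs => rw [← sum_starProjection_eigenspaces_isometry U ψ, map_sum]
    exact Finset.sum_congr rfl fun z _ => aeval_apply_of_mem_apply_eq_smul
      (mem_eigenspace_iff.1 (Submodule.starProjection_apply_mem _ ψ))
  have hortho := (orthogonalFamily_eigenspaces_isometry U).norm_sum
    (fun z => p.eval (z : ℂ) • ⟨(eigenspace U.toLinearMap (z : ℂ)).starProjection ψ,
      Submodule.starProjection_apply_mem _ ψ⟩) Finset.univ
  simp only [map_smul, Submodule.coe_subtypeₗᵢ, Submodule.subtype_apply, norm_smul, mul_pow,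
    Submodule.coe_norm] at hortho
  rw [haeval, hortho]

lemma norm_sq_eq_sum_norm_sq_starProjection_isometry (U : E →ₗᵢ[ℂ] E) (ψ : E) :
    ‖ψ‖ ^ 2 = ∑ z : Eigenvalues U.toLinearMap,
      ‖(eigenspace U.toLinearMap (z : ℂ)).starProjection ψ‖ ^ 2 := by
  simpa using norm_sq_aeval_isometry_apply U 1 ψ

lemma qhTail_antitone (U : Module.End ℂ E) (ψ : E) : Antitone (qhTail U ψ) := by
  intro x y hxy
  refine Finset.sum_le_sum fun z _ => ?_
  split_ifs with hy hx
  · exact le_rfl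
  · exact absurd (hxy.trans_lt hy) hx
  · positivity
  · exact le_rfl

lemma qhTail_le_of_epsHittingTime_le (U : Module.End ℂ E) (ψ : E) {ε T : ℝ} (hε : 0 < ε)
    (hT : epsHittingTime U ψ ε ≤ T) : qhTail U ψ T ≤ ε :=
  (qhTail_antitone U ψ hT).trans (epsHittingTime_isLeast U ψ ε hε).1.2

end SpectralWeights

section Damping

lemma eval_powerMean (N : ℕ) (z : ℂ) :
    (powerMean N).eval z = (N : ℂ)⁻¹ * ∑ k ∈ Finset.range N, z ^ k := by
  simp [powerMean, Polynomial.eval_finsetSum]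

lemma eval_powerMean_one {N : ℕ} (hN : N ≠ 0) : (powerMean N).eval 1 = 1 := by
  simp [eval_powerMean, hN]

lemma norm_eval_powerMean_le_one {z : ℂ} (hz : ‖z‖ ≤ 1) (N : ℕ) : ‖(powerMean N).eval z‖ ≤ 1 := by
  rw [eval_powerMean, norm_mul, norm_inv, Complex.norm_natCast]
  refine inv_mul_le_one_of_le₀ ((norm_sum_le _ _).trans ?_) N.cast_nonneg
  calc
    ∑ k ∈ Finset.range N, ‖z ^ k‖ ≤ ∑ _k ∈ Finset.range N, (1 : ℝ) :=
      Finset.sum_le_sum fun k _ => norm_pow z k ▸ pow_le_one₀ (norm_nonneg z) hz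
    _ = N := by simp

lemma norm_eval_powerMean_le_half {z : ℂ} (hz : ‖z‖ = 1) {N : ℕ}
    (hN : 2 * Real.pi ≤ N * |z.arg|) : ‖(powerMean N).eval z‖ ≤ 1 / 2 := by
  have hz1 : z ≠ 1 := by
    rintro rfl
    rw [Complex.arg_one, abs_zero, mul_zero] at hN
    linarith [Real.pi_pos]
  have hchord : 2 / Real.pi * |z.arg| ≤ ‖z - 1‖ := by
    rw [← Complex.angle_one_right (norm_ne_zero_iff.1 (hz ▸ one_ne_zero))]
    exact Complex.mul_angle_le_norm_sub hz norm_one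
  have hdenominator : 4 ≤ N * ‖z - 1‖ := by
    calc
      (4 : ℝ) = 2 / Real.pi * (2 * Real.pi) := by field_simp; norm_num
      _ ≤ 2 / Real.pi * (N * |z.arg|) := by gcongr
      _ = N * (2 / Real.pi * |z.arg|) := by ring
      _ ≤ N * ‖z - 1‖ := by gcongr
  have hnumerator : ‖z ^ N - 1‖ ≤ 2 := by
    refine (norm_sub_le _ _).trans (le_of_eq ?_)
    rw [norm_pow, hz, one_pow, norm_one, one_add_one_eq_two]
  rw [eval_powerMean, geom_sum_eq hz1, norm_mul, norm_div, norm_inv, Complex.norm_natCast,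
    inv_mul_eq_div, div_div, div_le_iff₀ (by linarith)]
  linarith

lemma two_pi_le_mul_abs_arg_of_qhValue_le {z : ℂ} (hz : ‖z‖ = 1) (hz1 : z ≠ 1) {N T : ℝ}
    (hzT : qhValue z ≤ T) (hN : 2 * Real.pi * T ≤ N) : 2 * Real.pi ≤ N * |z.arg| := by
  have harg : 0 < |z.arg| :=
    abs_pos.2 fun h => hz1 (Complex.ext_norm_arg (by simpa using hz) (by simpa using h))
  rw [qhValue, if_neg hz1, div_le_iff₀ harg] at hzT
  calc
    2 * Real.pi = 2 * Real.pi * 1 := (mul_one _).symm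
    _ ≤ 2 * Real.pi * (T * |z.arg|) := by gcongr
    _ = 2 * Real.pi * T * |z.arg| := by ring
    _ ≤ N * |z.arg| := by gcongr

open Module.End

variable {E : Type*} [NormedAddCommGroup E] [InnerProductSpace ℂ E]

lemma aeval_powerMean_pow_apply_of_fixed {U : Module.End ℂ E} {ψ : E} (hψ : U ψ = ψ) {N : ℕ}
    (hN : N ≠ 0) (k : ℕ) : Polynomial.aeval U (powerMean N ^ k) ψ = ψ := by
  rw [aeval_apply_of_mem_apply_eq_smul (hψ.trans (one_smul ℂ ψ).symm), Polynomial.eval_pow,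
    eval_powerMean_one hN, one_pow, one_smul]

lemma norm_sq_aeval_powerMean_pow_le [FiniteDimensional ℂ E] (U : E →ₗᵢ[ℂ] E)
    (hU : eigenspace U.toLinearMap 1 = ⊥) {T : ℝ} {N : ℕ} (hN : 2 * Real.pi * T ≤ N) (k : ℕ)
    (ψ : E) :
    ‖Polynomial.aeval U.toLinearMap (powerMean N ^ k) ψ‖ ^ 2 ≤
      qhTail U.toLinearMap ψ T + (1 / 4) ^ k * ‖ψ‖ ^ 2 := by
  rw [norm_sq_aeval_isometry_apply, norm_sq_eq_sum_norm_sq_starProjection_isometry U ψ, qhTail,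
    Finset.mul_sum, ← Finset.sum_add_distrib]
  refine Finset.sum_le_sum fun z _ => ?_
  have hz : ‖(z : ℂ)‖ = 1 := norm_eq_one_of_hasEigenvalue_isometry U z.2
  rw [Polynomial.eval_pow, norm_pow, pow_right_comm]
  split_ifs with hslow
  · refine le_add_of_le_of_nonneg (mul_le_of_le_one_left (by positivity) ?_) (by positivity)
    have := norm_eval_powerMean_le_one hz.le N
    exact pow_le_one₀ (by positivity) (pow_le_one₀ (by positivity) this)
  · have hz1 : (z : ℂ) ≠ 1 := fun h => z.2 ((congrArg (eigenspace U.toLinearMap) h).trans hU)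
    have hhalf : ‖(powerMean N).eval (z : ℂ)‖ ≤ 1 / 2 :=
      norm_eval_powerMean_le_half hz
        (two_pi_le_mul_abs_arg_of_qhValue_le hz hz1 (not_lt.1 hslow) hN)
    rw [zero_add]
    gcongr
    calc
      ‖(powerMean N).eval (z : ℂ)‖ ^ 2 ≤ (1 / 2) ^ 2 := by gcongr
      _ = 1 / 4 := by norm_num

end Damping

section Precision

lemma two_pi_mul_le_two_pow_precisionBits {T : ℝ} (hT : 0 < T) :
    2 * Real.pi * T ≤ (2 ^ precisionBits (1 / T) : ℕ) := by
  have hceil : Real.logb 2 (2 * Real.pi * T) ≤ (precisionBits (1 / T) : ℝ) := by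
    rw [precisionBits, div_div_eq_mul_div, div_one]
    exact Nat.le_ceil _
  rw [Real.logb_le_iff_le_rpow one_lt_two (by positivity), Real.rpow_natCast] at hceil
  exact_mod_cast hceil

lemma two_pow_precisionBits_le {T : ℝ} (hT : 1 ≤ 2 * Real.pi * T) :
    (2 : ℝ) ^ precisionBits (1 / T) ≤ 4 * Real.pi * T := by
  have hceil : (precisionBits (1 / T) : ℝ) ≤ Real.logb 2 (2 * Real.pi * T) + 1 := by
    rw [precisionBits, div_div_eq_mul_div, div_one]
    exact (Nat.ceil_lt_add_one (Real.logb_nonneg one_lt_two hT)).le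
  calc
    (2 : ℝ) ^ precisionBits (1 / T) ≤ 2 ^ (Real.logb 2 (2 * Real.pi * T) + 1) := by
      rw [← Real.rpow_natCast]
      exact Real.rpow_le_rpow_of_exponent_le one_le_two hceil
    _ = 2 * Real.pi * T * 2 := by
      rw [Real.rpow_add_one two_ne_zero,
        Real.rpow_logb two_pos (by norm_num) (zero_lt_one.trans_le hT)]
    _ = 4 * Real.pi * T := by ring

lemma one_div_pow_ceil_mul_log_le {a c ε : ℝ} (ha : 1 < a) (hc : 1 / Real.log a ≤ c) (hε : 0 < ε)
    (hε1 : ε ≤ 1) : (1 / a) ^ ⌈c * Real.log (1 / ε)⌉₊ ≤ ε := by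
  have hlog : 0 ≤ Real.log (1 / ε) := Real.log_nonneg (one_le_one_div hε hε1)
  have hceil : Real.log (1 / ε) ≤ ⌈c * Real.log (1 / ε)⌉₊ * Real.log a := by
    calc
      Real.log (1 / ε) ≤ c * Real.log a * Real.log (1 / ε) :=
        le_mul_of_one_le_left hlog ((div_le_iff₀ (Real.log_pos ha)).1 hc)
      _ = c * Real.log (1 / ε) * Real.log a := by ring
      _ ≤ ⌈c * Real.log (1 / ε)⌉₊ * Real.log a :=
        mul_le_mul_of_nonneg_right (Nat.le_ceil _) (Real.log_pos ha).le
  rw [← Real.log_pow, Real.log_le_log_iff (by positivity) (by positivity)] at hceil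
  rw [one_div_pow]
  exact (one_div_le hε (by positivity)).1 hceil

end Precision

section QueryCount

lemma controlledUCount_phaseEstimationCircuit (t : ℕ) :
    (phaseEstimationCircuit t).controlledUCount = 2 ^ t - 1 := by
  have hgeom : ((List.finRange t).map fun q : Fin t => 2 ^ (q : ℕ)).sum = 2 ^ t - 1 := by
    rw [← List.ofFn_eq_map, List.sum_ofFn, Fin.sum_univ_eq_sum_range fun i => 2 ^ i,
      Nat.geomSum_eq le_rfl, Nat.div_one]
  simp only [QCircuit.controlledUCount, phaseEstimationCircuit, List.map_append, List.sum_append,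
    List.map_map, List.flatMap]
  simp [Function.comp_def, QGate.cost, hgeom]

lemma controlledUCount_detect (c Δ ε : ℝ) :
    (detect c Δ ε).controlledUCount =
      ⌈c * Real.log (1 / ε)⌉₊ * (2 ^ precisionBits Δ - 1) := by
  simp [QProcedure.controlledUCount, detect, controlledUCount_phaseEstimationCircuit]

lemma controlledUCount_detect_le {c ε T : ℝ} (hc : 0 ≤ c) (hε : 0 < ε) (hε1 : ε ≤ 1)
    (hT : 1 ≤ T) :
    ((detect c (1 / T) ε).controlledUCount : ℝ) ≤
      4 * Real.pi * (c * Real.log (1 / ε) + 1) * T := by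
  have hlog : 0 ≤ Real.log (1 / ε) := Real.log_nonneg (one_le_one_div hε hε1)
  have hrounds : (⌈c * Real.log (1 / ε)⌉₊ : ℝ) ≤ c * Real.log (1 / ε) + 1 :=
    (Nat.ceil_lt_add_one (by positivity)).le
  have hround : ((2 ^ precisionBits (1 / T) - 1 : ℕ) : ℝ) ≤ 4 * Real.pi * T := by
    refine le_trans ?_ (two_pow_precisionBits_le (by nlinarith [Real.pi_gt_three]))
    exact_mod_cast Nat.sub_le _ _
  rw [controlledUCount_detect, Nat.cast_mul]
  calc
    _ ≤ (c * Real.log (1 / ε) + 1) * (4 * Real.pi * T) := by gcongr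
    _ = 4 * Real.pi * (c * Real.log (1 / ε) + 1) * T := by ring

lemma controlledUCount_detect_le_mul_one_add_log {c ε T : ℝ} (hc : 0 ≤ c) (hε : 0 < ε)
    (hε1 : ε ≤ 1) (hT : 1 ≤ T) :
    ((detect c (1 / T) ε).controlledUCount : ℝ) ≤
      4 * Real.pi * (c + 2) * (1 + Real.log (1 / ε)) * T := by
  have hlog : 0 ≤ Real.log (1 / ε) := Real.log_nonneg (one_le_one_div hε hε1)
  refine (controlledUCount_detect_le hc hε hε1 hT).trans ?_
  rw [mul_assoc (4 * Real.pi) (c + 2)]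
  gcongr
  linarith

lemma controlledUCount_detect_le_mul_log {c ε T : ℝ} (hc : 0 ≤ c) (hε : 0 < ε)
    (hε2 : ε ≤ 1 / 2) (hT : 1 ≤ T) :
    ((detect c (1 / T) ε).controlledUCount : ℝ) ≤
      4 * Real.pi * (c + 2) * Real.log (1 / ε) * T := by
  have hlog : 1 / 2 ≤ Real.log (1 / ε) := by
    have hmono : Real.log 2 ≤ Real.log (1 / ε) :=
      Real.log_le_log two_pos ((le_one_div two_pos hε).2 hε2)
    linarith [Real.log_two_gt_d9]
  refine (controlledUCount_detect_le hc hε (by linarith) hT).trans ?_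
  rw [mul_assoc (4 * Real.pi) (c + 2)]
  gcongr
  linarith

end QueryCount

section Detection

open Module.End

variable {E : Type*} [NormedAddCommGroup E] [InnerProductSpace ℂ E] (U : E →ₗᵢ[ℂ] E)

lemma acceptProb_detect_le (c Δ ε : ℝ) (ψ : E) :
    (detect c Δ ε).acceptProb U.toLinearMap ψ ≤ ‖ψ‖ ^ 2 := by
  rw [acceptProb_detect]
  exact sub_le_self _ (sq_nonneg _)

lemma acceptProb_detect_of_fixed {ψ : E} (hψ : U ψ = ψ) (c Δ ε : ℝ) :
    (detect c Δ ε).acceptProb U.toLinearMap ψ = 0 := by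
  rw [acceptProb_detect, aeval_powerMean_pow_apply_of_fixed hψ (by positivity), sub_self]

lemma le_acceptProb_detect [FiniteDimensional ℂ E] (hU : eigenspace U.toLinearMap 1 = ⊥)
    {c ε T : ℝ} (hc : 1 / Real.log 4 ≤ c) (hε : 0 < ε) (hε1 : ε ≤ 1) (hT : 0 < T) {ψ : E}
    (hqht : epsHittingTime U.toLinearMap ψ ε ≤ T) :
    ‖ψ‖ ^ 2 - (1 + ‖ψ‖ ^ 2) * ε ≤ (detect c (1 / T) ε).acceptProb U.toLinearMap ψ := by
  have hdamping := norm_sq_aeval_powerMean_pow_le U hU (two_pi_mul_le_two_pow_precisionBits hT)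
    ⌈c * Real.log (1 / ε)⌉₊ ψ
  have hslow : qhTail U.toLinearMap ψ T ≤ ε := qhTail_le_of_epsHittingTime_le _ _ hε hqht
  have hfast : (1 / 4 : ℝ) ^ ⌈c * Real.log (1 / ε)⌉₊ * ‖ψ‖ ^ 2 ≤ ε * ‖ψ‖ ^ 2 :=
    mul_le_mul_of_nonneg_right (one_div_pow_ceil_mul_log_le (by norm_num) hc hε hε1) (sq_nonneg _)
  rw [acceptProb_detect]
  linarith

end Detection

section AbstractSearch

open Module.End

variable {𝕜 E : Type*} [RCLike 𝕜] [NormedAddCommGroup E] [InnerProductSpace 𝕜 E]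

/-- The search operator of the isometry `V` with marked vector `m`: the reflection that negates `m`
and fixes its orthogonal complement, followed by `V`. Only the line spanned by `m` matters. -/
def searchIsometry (V : E →ₗᵢ[𝕜] E) (m : E) : E →ₗᵢ[𝕜] E :=
  V.comp (Submodule.span 𝕜 {m})ᗮ.reflection.toLinearIsometry

lemma searchIsometry_apply (V : E →ₗᵢ[𝕜] E) (m v : E) :
    searchIsometry V m v = V ((Submodule.span 𝕜 {m})ᗮ.reflection v) := rfl

lemma searchIsometry_apply_of_inner_eq_zero (V : E →ₗᵢ[𝕜] E) {m v : E} (hv : ⟪m, v⟫_𝕜 = 0) :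
    searchIsometry V m v = V v := by
  rw [searchIsometry_apply, Submodule.reflection_mem_subspace_eq_self
    (Submodule.mem_orthogonal_singleton_iff_inner_right.2 hv)]

lemma sub_reflection_orthogonal_mem (p : Submodule 𝕜 E) [p.HasOrthogonalProjection] (v : E) :
    v - pᗮ.reflection v ∈ p := by
  rw [Submodule.reflection_orthogonal_apply, sub_neg_eq_add, Submodule.reflection_apply,
    add_sub_cancel]
  exact nsmul_mem (p.starProjection_apply_mem v) 2

lemma apply_eq_self_of_eigenspace_eq_span {V : Module.End 𝕜 E} {φ : E}
    (hV : eigenspace V 1 = Submodule.span 𝕜 {φ}) : V φ = φ := by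
  have hφ : φ ∈ eigenspace V 1 := hV ▸ Submodule.mem_span_singleton_self φ
  rwa [mem_eigenspace_iff, one_smul] at hφ

lemma eigenspace_searchIsometry_one {V : E →ₗᵢ[𝕜] E} {m φ : E}
    (hV : eigenspace V.toLinearMap 1 = Submodule.span 𝕜 {φ}) (hφm : ⟪φ, m⟫_𝕜 ≠ 0) :
    eigenspace (searchIsometry V m).toLinearMap 1 = ⊥ := by
  have hVφ : V φ = φ := apply_eq_self_of_eigenspace_eq_span hV
  refine (Submodule.eq_bot_iff _).2 fun v hv => ?_
  rw [mem_eigenspace_iff, one_smul, LinearIsometry.coe_toLinearMap, searchIsometry_apply] at hv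
  -- `V` preserves overlaps with its fixed vector `φ`, so `⟪φ, v⟫ = ⟪φ, R v⟫` for the reflection `R`
  -- in `mᗮ`; since `v - R v` is a multiple of `m`, it vanishes.
  obtain ⟨b, hb⟩ := Submodule.mem_span_singleton.1
    (sub_reflection_orthogonal_mem (Submodule.span 𝕜 {m}) v)
  have hoverlap : ⟪φ, (Submodule.span 𝕜 {m})ᗮ.reflection v⟫_𝕜 = ⟪φ, v⟫_𝕜 := by
    rw [← V.inner_map_map, hVφ, hv]
  have hb0 : b = 0 := by
    have hinner : b * ⟪φ, m⟫_𝕜 = 0 := by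
      rw [← inner_smul_right, hb, inner_sub_right, hoverlap, sub_self]
    exact (mul_eq_zero.1 hinner).resolve_right hφm
  have hreflection : (Submodule.span 𝕜 {m})ᗮ.reflection v = v := by
    rw [hb0, zero_smul] at hb
    exact (sub_eq_zero.1 hb.symm).symm
  rw [hreflection] at hv
  obtain ⟨a, rfl⟩ := Submodule.mem_span_singleton.1
    (hV ▸ mem_eigenspace_iff.2 (hv.trans (one_smul 𝕜 v).symm))
  have hinner : a * ⟪m, φ⟫_𝕜 = 0 := by
    rw [← inner_smul_right]
    exact Submodule.mem_orthogonal_singleton_iff_inner_right.1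
      ((Submodule.reflection_eq_self_iff _).1 hreflection)
  rw [(mul_eq_zero.1 hinner).resolve_right (inner_eq_zero_symm.not.1 hφm), zero_smul]

lemma starProjection_orthogonal_singleton_of_inner_eq_zero {m φ : E} (hφm : ⟪φ, m⟫_𝕜 = 0) :
    (Submodule.span 𝕜 {m})ᗮ.starProjection φ = φ :=
  Submodule.starProjection_eq_self_iff.2
    (Submodule.mem_orthogonal_singleton_iff_inner_left.2 hφm)

end AbstractSearch

section RealMatrices

open Module.End

variable {ι : Type*} [Fintype ι]

lemma inner_complexify (v w : EuclideanSpace ℝ ι) :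
    ⟪complexify v, complexify w⟫_ℂ = (⟪v, w⟫_ℝ : ℂ) := by
  simp [complexify, PiLp.inner_apply]

lemma norm_complexify (v : EuclideanSpace ℝ ι) : ‖complexify v‖ = ‖v‖ := by
  simp [complexify, EuclideanSpace.norm_eq]

lemma complexify_startVector {μ : EuclideanSpace ℝ ι} (hμ : ‖μ‖ = 1) (φ₀ : EuclideanSpace ℝ ι) :
    complexify (startVector μ φ₀) =
      (Submodule.span ℂ {complexify μ})ᗮ.starProjection (complexify φ₀) := by
  rw [Submodule.starProjection_orthogonal_val,
    Submodule.starProjection_unit_singleton ℂ (by rw [norm_complexify, hμ]), inner_complexify]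
  ext x
  simp [startVector, complexify]

variable [DecidableEq ι]

lemma map_ofReal_mem_unitaryGroup {A : Matrix ι ι ℝ} (hA : A ∈ Matrix.orthogonalGroup ι ℝ) :
    A.map Complex.ofReal ∈ Matrix.unitaryGroup ι ℂ := by
  rw [Matrix.mem_unitaryGroup_iff', Matrix.star_eq_conjTranspose,
    ← Matrix.conjTranspose_map _ fun r => (Complex.conj_ofReal r).symm]
  change A.conjTranspose.map Complex.ofRealHom * A.map Complex.ofRealHom = 1
  rw [← Matrix.map_mul, ← Matrix.star_eq_conjTranspose, Matrix.mem_unitaryGroup_iff'.1 hA,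
    Matrix.map_one _ (map_zero _) (map_one _)]

/-- The linear isometry of the Euclidean space given by a unitary matrix. -/
def unitaryIsometry {𝕜 : Type*} [RCLike 𝕜] (A : Matrix.unitaryGroup ι 𝕜) :
    EuclideanSpace 𝕜 ι →ₗᵢ[𝕜] EuclideanSpace 𝕜 ι :=
  (Unitary.linearIsometryEquiv
    ⟨Matrix.toEuclideanCLM (n := ι) (𝕜 := 𝕜) A,
      Unitary.map_mem (Matrix.toEuclideanCLM (n := ι) (𝕜 := 𝕜)) A.2⟩).toLinearIsometry

lemma toLinearMap_unitaryIsometry {𝕜 : Type*} [RCLike 𝕜] (A : Matrix.unitaryGroup ι 𝕜) :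
    (unitaryIsometry A).toLinearMap = Matrix.toEuclideanLin (A : Matrix ι ι 𝕜) := rfl

lemma toEuclideanLin_one_sub_two_smul_vecMulVec {𝕜 : Type*} [RCLike 𝕜] {x : EuclideanSpace 𝕜 ι}
    (hx : ‖x‖ = 1) (v : EuclideanSpace 𝕜 ι) :
    Matrix.toEuclideanLin (1 - (2 : 𝕜) • Matrix.vecMulVec x.ofLp (star x.ofLp)) v =
      (Submodule.span 𝕜 {x})ᗮ.reflection v := by
  rw [← InnerProductSpace.symm_toEuclideanLin_rankOne, Submodule.reflection_orthogonal_apply,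
    Submodule.reflection_apply, Submodule.starProjection_unit_singleton 𝕜 hx, neg_sub, map_sub,
    map_smul, LinearEquiv.apply_symm_apply, Matrix.toLpLin_one, two_smul, two_smul]
  rfl

lemma searchOperator_eq_searchIsometry {U₂ : Matrix ι ι ℝ}
    (hU₂ : U₂ ∈ Matrix.orthogonalGroup ι ℝ) {μ : EuclideanSpace ℝ ι} (hμ : ‖μ‖ = 1) :
    searchOperator U₂ μ = (searchIsometry
      (unitaryIsometry ⟨_, map_ofReal_mem_unitaryGroup hU₂⟩) (complexify μ)).toLinearMap := by
  have hmap : (U₂ * (1 - (2 : ℝ) • Matrix.vecMulVec (fun x => μ x) (fun x => μ x))).map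
      Complex.ofReal = U₂.map Complex.ofReal *
        (1 - (2 : ℂ) • Matrix.vecMulVec (complexify μ).ofLp (star (complexify μ).ofLp)) := by
    change Matrix.map _ Complex.ofRealHom = Matrix.map _ Complex.ofRealHom * _
    rw [Matrix.map_mul]
    congr 1
    ext i j
    by_cases h : i = j <;> simp [complexify, Matrix.vecMulVec_apply, h]
  ext v : 1
  rw [searchOperator, hmap, Matrix.toLpLin_mul_same, LinearMap.comp_apply,
    toEuclideanLin_one_sub_two_smul_vecMulVec (by rw [norm_complexify, hμ]),
    LinearIsometry.coe_toLinearMap, searchIsometry_apply, ← LinearIsometry.coe_toLinearMap,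
    toLinearMap_unitaryIsometry]

lemma toEuclideanLin_map_ofReal_complexify (A : Matrix ι ι ℝ) (v : EuclideanSpace ℝ ι) :
    Matrix.toEuclideanLin (A.map Complex.ofReal) (complexify v) =
      complexify (Matrix.toEuclideanLin A v) := by
  ext x
  simp [complexify, Matrix.toLpLin_apply, Matrix.mulVec, dotProduct]

lemma eigenspace_toEuclideanLin_map_ofReal_one {A : Matrix ι ι ℝ} {φ : EuclideanSpace ℝ ι}
    (h : eigenspace (Matrix.toEuclideanLin A) 1 = Submodule.span ℝ {φ}) :
    eigenspace (Matrix.toEuclideanLin (A.map Complex.ofReal)) 1 =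
      Submodule.span ℂ {complexify φ} := by
  have exists_smul_eq {w : EuclideanSpace ℝ ι} (hw : Matrix.toEuclideanLin A w = w) :
      ∃ a : ℝ, a • φ = w := by
    rw [← Submodule.mem_span_singleton, ← h, mem_eigenspace_iff, hw, one_smul]
  refine le_antisymm (fun v hv => ?_) ((Submodule.span_singleton_le_iff_mem _ _).2 ?_)
  · rw [mem_eigenspace_iff, one_smul] at hv
    have hcoord (x : ι) := congrArg (fun w : EuclideanSpace ℂ ι => w x) hv
    obtain ⟨a, ha⟩ := exists_smul_eq (w := WithLp.toLp 2 fun x => (v x).re) (by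
      ext x
      simpa [Matrix.toLpLin_apply, Matrix.mulVec, dotProduct] using congrArg Complex.re (hcoord x))
    obtain ⟨b, hb⟩ := exists_smul_eq (w := WithLp.toLp 2 fun x => (v x).im) (by
      ext x
      simpa [Matrix.toLpLin_apply, Matrix.mulVec, dotProduct] using congrArg Complex.im (hcoord x))
    refine Submodule.mem_span_singleton.2 ⟨⟨a, b⟩, ?_⟩
    ext x
    have hre : a * φ x = (v x).re := congrArg (fun w : EuclideanSpace ℝ ι => w x) ha
    have him : b * φ x = (v x).im := congrArg (fun w : EuclideanSpace ℝ ι => w x) hb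
    apply Complex.ext <;> simp [complexify, ← hre, ← him]
  · rw [mem_eigenspace_iff, one_smul, toEuclideanLin_map_ofReal_complexify,
      apply_eq_self_of_eigenspace_eq_span h]

end RealMatrices

end

theorem mainTheorem7_general (c : ℝ) (hc : 1 / Real.log 4 ≤ c) :
    ∃ K : ℝ, 0 < K ∧
      ∀ (E : Type*) [NormedAddCommGroup E] [InnerProductSpace ℂ E] [FiniteDimensional ℂ E]
        (V : E →ₗᵢ[ℂ] E) (m φ : E) (ε T : ℝ),
        ‖φ‖ = 1 →
        Module.End.eigenspace V.toLinearMap 1 = Submodule.span ℂ {φ} →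
        0 < ε → ε < 1 →
        max 1 (epsHittingTime (searchIsometry V m).toLinearMap
          ((Submodule.span ℂ {m})ᗮ.starProjection φ) ε) ≤ T →
        (⟪φ, m⟫_ℂ ≠ 0 →
          ‖(Submodule.span ℂ {m})ᗮ.starProjection φ‖ ^ 2 - K * ε ≤
              (detect c (1 / T) ε).acceptProb (searchIsometry V m).toLinearMap
                ((Submodule.span ℂ {m})ᗮ.starProjection φ) ∧
            (detect c (1 / T) ε).acceptProb (searchIsometry V m).toLinearMap
                ((Submodule.span ℂ {m})ᗮ.starProjection φ) ≤
              ‖(Submodule.span ℂ {m})ᗮ.starProjection φ‖ ^ 2) ∧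
        (⟪φ, m⟫_ℂ = 0 →
          (detect c (1 / T) ε).acceptProb (searchIsometry V m).toLinearMap
            ((Submodule.span ℂ {m})ᗮ.starProjection φ) = 0) ∧
        ((detect c (1 / T) ε).controlledUCount : ℝ) ≤ K * (1 + Real.log (1 / ε)) * T ∧
        (ε ≤ 1 / 2 →
          ((detect c (1 / T) ε).controlledUCount : ℝ) ≤ K * Real.log (1 / ε) * T) := by
  have hc0 : 0 ≤ c := le_trans (by positivity) hc
  refine ⟨4 * Real.pi * (c + 2), by positivity, ?_⟩
  intro E _ _ _ V m φ ε T hφ hV hε hε1 hT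
  obtain ⟨hT1, hqht⟩ := max_le_iff.1 hT
  refine ⟨fun hne => ⟨?_, acceptProb_detect_le _ _ _ _ _⟩, fun heq => ?_,
    controlledUCount_detect_le_mul_one_add_log hc0 hε hε1.le hT1,
    fun hε2 => controlledUCount_detect_le_mul_log hc0 hε hε2 hT1⟩
  · have hdetect := le_acceptProb_detect _ (eigenspace_searchIsometry_one hV hne) hc hε hε1.le
      (zero_lt_one.trans_le hT1) hqht
    have hnorm : ‖(Submodule.span ℂ {m})ᗮ.starProjection φ‖ ^ 2 ≤ 1 :=
      pow_le_one₀ (norm_nonneg _) (hφ ▸ Submodule.norm_starProjection_apply_le _ _)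
    have hK : 1 + ‖(Submodule.span ℂ {m})ᗮ.starProjection φ‖ ^ 2 ≤ 4 * Real.pi * (c + 2) := by
      nlinarith [Real.pi_gt_three]
    linarith [mul_le_mul_of_nonneg_right hK hε.le]
  · rw [starProjection_orthogonal_singleton_of_inner_eq_zero heq]
    refine acceptProb_detect_of_fixed _ ?_ _ _ _
    rw [searchIsometry_apply_of_inner_eq_zero V (inner_eq_zero_symm.1 heq)]
    exact apply_eq_self_of_eigenspace_eq_span hV

theorem mainTheorem7 (c : ℝ) (hc : 1 / Real.log 3 ≤ c) :
    ∃ K : ℝ, 0 < K ∧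
      ∀ (ι : Type*) [Fintype ι] [DecidableEq ι]
        (U₂ : Matrix ι ι ℝ) (μ φ₀ : EuclideanSpace ℝ ι) (ε T : ℝ),
        U₂ ∈ Matrix.orthogonalGroup ι ℝ →
        ‖μ‖ = 1 →
        ‖φ₀‖ = 1 →
        Module.End.eigenspace (Matrix.toEuclideanLin U₂) 1 = Submodule.span ℝ {φ₀} →
        0 < ε → ε < 1 →
        max 1 (quantumHittingTime U₂ μ φ₀ ε) ≤ T →
        (⟪φ₀, μ⟫_ℝ ≠ 0 →
          ‖startVector μ φ₀‖ ^ 2 - K * ε ≤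
              (detect c (1 / T) ε).acceptProb (searchOperator U₂ μ)
                (complexify (startVector μ φ₀)) ∧
            (detect c (1 / T) ε).acceptProb (searchOperator U₂ μ)
                (complexify (startVector μ φ₀)) ≤ ‖startVector μ φ₀‖ ^ 2) ∧
        (⟪φ₀, μ⟫_ℝ = 0 →
          (detect c (1 / T) ε).acceptProb (searchOperator U₂ μ)
            (complexify (startVector μ φ₀)) = 0) ∧
        ((detect c (1 / T) ε).controlledUCount : ℝ) ≤ K * (1 + Real.log (1 / ε)) * T ∧
        (ε ≤ 1 / 2 →
          ((detect c (1 / T) ε).controlledUCount : ℝ) ≤ K * Real.log (1 / ε) * T) := by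
  have hlog : Real.log 3 ≤ Real.log 4 := Real.log_le_log (by norm_num) (by norm_num)
  obtain ⟨K, hK, hgeneral⟩ := mainTheorem7_general c
    ((one_div_le_one_div_of_le (Real.log_pos (by norm_num)) hlog).trans hc)
  refine ⟨K, hK, ?_⟩
  intro ι _ _ U₂ μ φ₀ ε T hU₂ hμ hφ₀ heigenspace hε hε1 hT
  have h := hgeneral _ (unitaryIsometry ⟨_, map_ofReal_mem_unitaryGroup hU₂⟩) (complexify μ)
    (complexify φ₀) ε T (by rw [norm_complexify, hφ₀])
    (by rw [toLinearMap_unitaryIsometry, eigenspace_toEuclideanLin_map_ofReal_one heigenspace])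
    hε hε1
  rw [← searchOperator_eq_searchIsometry hU₂ hμ, ← complexify_startVector hμ, norm_complexify,
    inner_complexify, ne_eq, Complex.ofReal_eq_zero] at h
  exact h hT
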